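/- Let $A$ be a finite alphabet and $X=X_0X_1X_2\cdots\in A^{\mathbb N}$. Then $X$ is primitive substitutive if and only if $X$ is minimal and the set $\{\mathcal D_u(X) : u \text{ a non-empty prefix of } X\}$ of its derived sequences is finite. Definitions. A sequence $X$ is minimal (uniformly recurrent) if for every integer $l\ge 0$ there is an integer $k$ such that every factor of $X$ of length $l$ occurs in every factor of $X$ of length $k$. A substitution on a finite alphabet $B$ is a map $\zeta$ from $B$ to the set of non-empty words on $B$, extended to words by concatenation, together with a letter $\alpha\in B$ such that $\alpha$ is the first letter of $\zeta(\alpha)$ and $|\zeta^n(\alpha)|\to+\infty$; its fixed point $X_\zeta$ is the sequence of which every $\zeta^n(\alpha)$ is a prefix. It is primitive if for some $k$ every letter of $B$ occurs in $\zeta^k(\beta)$ for every $\beta\in B$. The sequence $X$ is primitive substitutive if $X=\varphi(X_\zeta)$ for some finite alphabet $B$, some primitive substitution $\zeta$ on $B$ and some letter-to-letter map $\varphi:B\to A$. If $X$ is minimal, $u$ is a non-empty prefix of $X$ and $0=i_0<i_1<i_2<\cdots$ are the occurrences of $u$ in $X$, the return words over $u$ are the words $m_n=X_{i_n}X_{i_n+1}\cdots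 X_{i_{n+1}-1}$, so that $X=m_0m_1m_2\cdots$. Number the distinct return words $1,2,3,\dots$ in the order of their first appearance in $m_0,m_1,m_2,\dots$; the derived sequence $\mathcal D_u(X)$ is the sequence of positive integers whose $n$-th term is the number of $m_n$. -/

import Mathlib

/-- The factor `X_i X_{i+1} ⋯ X_{i+n-1}` of length `n` of the sequence `X`. -/
def seqFactor {A : Type*} (X : ℕ → A) (i n : ℕ) : List A :=
  (List.range n).map fun k => X (i + k)

/-- The integer `i` is an occurrence of the word `u` in the sequence `X`. -/
def OccursAt {A : Type*} (X : ℕ → A) (u : List A) (i : ℕ) : Prop :=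
  seqFactor X i u.length = u

/-- The word `u` is a prefix of the sequence `X`. -/
def IsSeqPrefix {A : Type*} (u : List A) (X : ℕ → A) : Prop :=
  OccursAt X u 0

/-- Minimal (uniformly recurrent) sequences: for every `l` there is `k` such that each factor of
length `l` of `X` occurs in each factor of length `k` of `X`. -/
def IsMinimalSeq {A : Type*} (X : ℕ → A) : Prop :=
  ∀ l : ℕ, ∃ k : ℕ, ∀ i j : ℕ, seqFactor X i l <:+: seqFactor X j k

/-- The map on words induced, by concatenation, by a map from letters to words. -/
def wordMap {A B : Type*} (f : A → List B) (w : List A) : List B :=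
  w.flatMap f

/-- A substitution on `B`: a map from letters to non-empty words together with a letter `start`
which is the first letter of its image and whose iterated images have lengths tending to
infinity. -/
structure Substitution (B : Type*) where
  /-- The images of the letters. -/
  toFun : B → List B
  toFun_ne_nil : ∀ b, toFun b ≠ []
  /-- The distinguished letter. -/
  start : B
  head_start : (toFun start).head? = some start
  tendsto_length : Filter.Tendsto (fun n : ℕ => ((wordMap toFun)^[n] [start]).length)
    Filter.atTop Filter.atTop

namespace Substitution

variable {B : Type*}

/-- The word `ζ ^ n (b)`. -/
def iter (ζ : Substitution B) (n : ℕ) (b : B) : List B :=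
  (wordMap ζ.toFun)^[n] [b]

theorem exists_lt_length (ζ : Substitution B) (n : ℕ) :
    ∃ i, n < (ζ.iter i ζ.start).length :=
  (ζ.tendsto_length.eventually_gt_atTop n).exists

/-- The sequence `lim ζ ^ i (start)`: its `n`-th letter is the `n`-th letter of `ζ ^ i (start)`
for the first `i` for which this word is long enough. -/
noncomputable def fixedPoint (ζ : Substitution B) (n : ℕ) : B :=
  (ζ.iter (Nat.find (ζ.exists_lt_length n)) ζ.start)[n]'(Nat.find_spec (ζ.exists_lt_length n))

theorem iter_prefix_succ (ζ : Substitution B) (i : ℕ) :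
    ζ.iter i ζ.start <+: ζ.iter (i + 1) ζ.start := by
  induction i with
  | zero =>
    obtain ⟨t, ht⟩ : ∃ t, ζ.toFun ζ.start = ζ.start :: t := by
      have h := ζ.head_start
      cases hc : ζ.toFun ζ.start with
      | nil => simp [hc] at h
      | cons a t => exact ⟨t, by simp [hc] at h; rw [h]⟩
    exact ⟨t, by simp [iter, wordMap, ht]⟩
  | succ i ih =>
    obtain ⟨t, ht⟩ := ih
    refine ⟨wordMap ζ.toFun t, ?_⟩
    have key : ∀ j b, ζ.iter (j + 1) b = wordMap ζ.toFun (ζ.iter j b) := fun j b => by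
      simp only [iter, Function.iterate_succ_apply']
    have h2 : wordMap ζ.toFun (ζ.iter i ζ.start ++ t) =
        wordMap ζ.toFun (ζ.iter i ζ.start) ++ wordMap ζ.toFun t := List.flatMap_append
    rw [key (i + 1), ← ht, h2, ht, key i]

theorem iter_prefix (ζ : Substitution B) {i j : ℕ} (h : i ≤ j) :
    ζ.iter i ζ.start <+: ζ.iter j ζ.start := by
  induction h with
  | refl => exact List.prefix_rfl
  | step _ ih => exact ih.trans (ζ.iter_prefix_succ _)

/-- The word `ζ ^ i (start)` is a prefix of the fixed point for every `i`; as the lengths of these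
words are unbounded, this determines the fixed point. -/
theorem iter_isSeqPrefix_fixedPoint (ζ : Substitution B) (i : ℕ) :
    IsSeqPrefix (ζ.iter i ζ.start) ζ.fixedPoint := by
  unfold IsSeqPrefix OccursAt seqFactor
  apply List.ext_getElem
  · simp
  · intro n h1 h2
    have h3 := Nat.find_spec (ζ.exists_lt_length n)
    have h4 : Nat.find (ζ.exists_lt_length n) ≤ i := Nat.find_min' _ h2
    simp only [List.getElem_map, List.getElem_range, zero_add]
    exact (ζ.iter_prefix h4).getElem h3

/-- Primitive substitutions: for some `k`, every letter occurs in `ζ ^ k (b)` for every letter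
`b`. -/
def IsPrimitive (ζ : Substitution B) : Prop :=
  ∃ k : ℕ, ∀ b c : B, c ∈ ζ.iter k b

end Substitution

/-- Primitive substitutive sequences: images, under a letter-to-letter map, of the fixed point of
a primitive substitution on a finite alphabet. -/
def IsPrimitiveSubstitutive {A : Type*} (X : ℕ → A) : Prop :=
  ∃ (B : Type) (_ : Finite B) (ζ : Substitution B) (φ : B → A),
    ζ.IsPrimitive ∧ X = φ ∘ ζ.fixedPoint

/-- The `n`-th occurrence of `u` in `X`, in increasing order and counted from `0` (used when `u`
has infinitely many occurrences). -/
noncomputable def occurrence {A : Type*} (X : ℕ → A) (u : List A) (n : ℕ) : ℕ :=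
  Nat.nth (OccursAt X u) n

/-- The return word `m_n` over `u`: the factor of `X` that starts at the `n`-th occurrence of `u`
and ends just before the next one. If `u` is a prefix of `X` then `X = m_0 m_1 m_2 ⋯`. -/
noncomputable def returnWord {A : Type*} (X : ℕ → A) (u : List A) (n : ℕ) : List A :=
  seqFactor X (occurrence X u n) (occurrence X u (n + 1) - occurrence X u n)

/-- The rank of first appearance of the return word `w` in the sequence `m_0, m_1, m_2, …`,
counted from `1`: the number of distinct return words among `m_0, …, m_k`, where `k` is the least
index with `m_k = w`. -/
noncomputable def returnRank {A : Type*} (X : ℕ → A) (u : List A) (w : List A) : ℕ :=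
  (returnWord X u '' Set.Iic (sInf {k | returnWord X u k = w})).ncard

/-- The derived sequence of `X` with respect to `u`: the coding of `X = m_0 m_1 m_2 ⋯` by the ranks
of the return words. -/
noncomputable def derivedSeq {A : Type*} (X : ℕ → A) (u : List A) (n : ℕ) : ℕ :=
  returnRank X u (returnWord X u n)

/-- The set of derived sequences of `X`, over all non-empty prefixes of `X`. -/
def derivedSeqs {A : Type*} (X : ℕ → A) : Set (ℕ → ℕ) :=
  {D | ∃ u : List A, u ≠ [] ∧ IsSeqPrefix u X ∧ D = derivedSeq X u}

/-! Periodic sequences are handled directly in both directions; otherwise return words grow with the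
prefix. From finiteness to a substitution: by pigeonhole a prefix `u` shares its derived sequence
with a much longer prefix `v`, so the `k`-th return word over `u` determines the `k`-th one over
`v`. Code each position by the return word over `u` containing it and its offset there. Distributing
the `k`-th return word over `v`, so coded, among the letters of the `k`-th one over `u` gives a
substitution fixing the coding. As `v` is long, every image contains every letter, so primitivity
holds with exponent 1 (`exists_primitive_fixedPoint`). Conversely, fixed points of primitive
substitutions are linearly recurrent (`exists_linear_recurrence`). For the prefix of length `n`, cut
the sequence into images of letters under an iterate whose lengths are comparable to `n`. A window
of boundedly many letters of the fixed point, with a bound independent of `n`, determines the return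
words starting in a block, and these are boundedly many. Finitely many data thus decide which return
words coincide (`exists_finite_pattern`), and this equality pattern is all that the derived sequence
sees (`derivedSeq_eq_of_returnWord`). -/

/-! ### Factors and prefixes -/

section Factors

variable {A : Type*} {X : ℕ → A}

@[simp]
theorem length_seqFactor (X : ℕ → A) (i n : ℕ) : (seqFactor X i n).length = n := by
  simp [seqFactor]

theorem getElem_seqFactor (X : ℕ → A) (i n r : ℕ) (h : r < (seqFactor X i n).length) :
    (seqFactor X i n)[r] = X (i + r) := by
  simp [seqFactor]

theorem seqFactor_eq_iff {i j n : ℕ} :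
    seqFactor X i n = seqFactor X j n ↔ ∀ r < n, X (i + r) = X (j + r) := by
  simp [seqFactor]

theorem seqFactor_add (X : ℕ → A) (i m n : ℕ) :
    seqFactor X i (m + n) = seqFactor X i m ++ seqFactor X (i + m) n := by
  simp [seqFactor, List.range_add, Function.comp_def, add_assoc]

theorem seqFactor_infix {a m b n : ℕ} (h : b ≤ a) (h' : a + m ≤ b + n) :
    seqFactor X a m <:+: seqFactor X b n := by
  obtain ⟨c, rfl⟩ := Nat.exists_eq_add_of_le h
  obtain ⟨d, rfl⟩ : ∃ d, n = c + m + d := ⟨n - (c + m), by omega⟩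
  exact ⟨seqFactor X b c, seqFactor X (b + (c + m)) d, by rw [seqFactor_add, seqFactor_add]⟩

theorem exists_offset_of_infix {i l j k : ℕ} (h : seqFactor X i l <:+: seqFactor X j k) :
    ∃ t, t + l ≤ k ∧ ∀ r < l, X (i + r) = X (j + t + r) := by
  obtain ⟨a, b, hab⟩ := h
  have hl := congrArg List.length hab
  simp only [List.length_append, length_seqFactor] at hl
  refine ⟨a.length, by omega, fun r hr => ?_⟩
  have h1 : (seqFactor X j k)[a.length + r]'(by simp; omega) = X (j + (a.length + r)) :=
    getElem_seqFactor ..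
  rw [add_assoc, ← h1, ← getElem_seqFactor X i l r (by simpa using hr)]
  simp only [← hab, List.append_assoc]
  rw [List.getElem_append_right (by omega), List.getElem_append_left (by simp; omega)]
  simp

theorem infix_of_offset {i l j k t : ℕ} (ht : t + l ≤ k)
    (h : ∀ r < l, X (i + r) = X (j + t + r)) : seqFactor X i l <:+: seqFactor X j k := by
  rw [seqFactor_eq_iff.2 h]
  exact seqFactor_infix (by omega) (by omega)

theorem occursAt_prefix_iff {n i : ℕ} :
    OccursAt X (seqFactor X 0 n) i ↔ ∀ r < n, X (i + r) = X r := by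
  rw [OccursAt, length_seqFactor, seqFactor_eq_iff]
  simp

theorem occursAt_prefix_zero (X : ℕ → A) (n : ℕ) : OccursAt X (seqFactor X 0 n) 0 := by
  simp [occursAt_prefix_iff]

theorem derivedSeqs_eq_image (X : ℕ → A) :
    derivedSeqs X = (fun n => derivedSeq X (seqFactor X 0 n)) '' {n | 1 ≤ n} := by
  ext D
  constructor
  · rintro ⟨u, hu, hp, rfl⟩
    refine ⟨u.length, List.length_pos_iff.2 hu, ?_⟩
    have : seqFactor X 0 u.length = u := hp
    simp only [this]
  · rintro ⟨n, hn, rfl⟩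
    refine ⟨_, fun h => ?_, ?_, rfl⟩
    · have := congrArg List.length h
      simp at this hn
      omega
    · exact occursAt_prefix_zero X n

/-- Prefixes of a minimal sequence recur with bounded gaps. -/
theorem IsMinimalSeq.exists_gap (h : IsMinimalSeq X) (n : ℕ) :
    ∃ G, ∀ i, ∃ j, i < j ∧ j ≤ i + G ∧ OccursAt X (seqFactor X 0 n) j := by
  obtain ⟨k, hk⟩ := h n
  refine ⟨k + 1, fun i => ?_⟩
  obtain ⟨t, ht, ha⟩ := exists_offset_of_infix (hk 0 (i + 1))
  refine ⟨i + 1 + t, by omega, by omega, occursAt_prefix_iff.2 fun r hr => ?_⟩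
  rw [← ha r hr, zero_add]

end Factors

/-! ### Derived sequences and equality of return words -/

section Derived

variable {A A' : Type*}

/-- The sets of return words seen up to two first appearances are nested; equal cardinality makes
them equal, so neither word can appear later than the other. -/
theorem returnWord_eq_of_derivedSeq_eq {X : ℕ → A} {u : List A} {m n : ℕ}
    (h : derivedSeq X u m = derivedSeq X u n) : returnWord X u m = returnWord X u n := by
  wlog hle : sInf {k | returnWord X u k = returnWord X u m} ≤
      sInf {k | returnWord X u k = returnWord X u n} generalizing m n
  · exact (this h.symm (by omega)).symm
  have spec : ∀ i, returnWord X u (sInf {k | returnWord X u k = returnWord X u i}) =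
      returnWord X u i := fun i => Nat.sInf_mem (s := {k | returnWord X u k = returnWord X u i})
    ⟨i, rfl⟩
  have hsub : returnWord X u '' Set.Iic (sInf {k | returnWord X u k = returnWord X u m}) ⊆
      returnWord X u '' Set.Iic (sInf {k | returnWord X u k = returnWord X u n}) :=
    Set.image_mono (Set.Iic_subset_Iic.2 hle)
  have heq := Set.eq_of_subset_of_ncard_le hsub (le_of_eq h.symm) ((Set.finite_Iic _).image _)
  have hmem : returnWord X u n ∈
      returnWord X u '' Set.Iic (sInf {k | returnWord X u k = returnWord X u m}) := by
    rw [heq]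
    exact ⟨_, Set.mem_Iic.2 le_rfl, spec n⟩
  obtain ⟨k, hk, hkn⟩ := hmem
  have h1 : sInf {k | returnWord X u k = returnWord X u n} ≤ k := Nat.sInf_le hkn
  have h2 : sInf {k | returnWord X u k = returnWord X u m} =
      sInf {k | returnWord X u k = returnWord X u n} := le_antisymm hle (h1.trans hk)
  rw [← spec m, h2, spec n]

/-- The derived sequence depends only on the equality pattern of the return words. -/
theorem derivedSeq_eq_of_returnWord {X : ℕ → A} {u : List A} {X' : ℕ → A'} {u' : List A'}
    (h : ∀ m n, returnWord X u m = returnWord X u n ↔ returnWord X' u' m = returnWord X' u' n) :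
    derivedSeq X u = derivedSeq X' u' := by
  funext n
  simp only [derivedSeq, returnRank, h]
  set S := Set.Iic (sInf {k | returnWord X' u' k = returnWord X' u' n})
  classical
  choose! g hg using fun (w : List A) (hw : w ∈ returnWord X u '' S) => hw
  refine Set.ncard_congr (fun w _ => returnWord X' u' (g w)) (fun w hw => ?_)
    (fun w w' hw hw' he => ?_) ?_
  · exact ⟨_, (hg w hw).1, rfl⟩
  · rw [← (hg w hw).2, ← (hg w' hw').2]
    exact (h _ _).2 he
  · rintro _ ⟨k, hk, rfl⟩
    have hm : returnWord X u k ∈ returnWord X u '' S := ⟨k, hk, rfl⟩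
    exact ⟨_, hm, (h _ _).1 (hg _ hm).2⟩

end Derived

/-! ### Self-similar sequences as fixed points -/

section SelfSimilar

/-- A sequence over a finite alphabet that is the image of itself under a map of letters to long
words, each containing all letters, is the fixed point of a primitive substitution. -/
theorem exists_primitive_fixedPoint {B : Type*} (Z : ℕ → B) (hZ : Function.Surjective Z)
    {f : ℕ → ℕ} {R : ℕ} (hR : 2 ≤ R) (f0 : f 0 = 0) (hf : ∀ x, f x + R ≤ f (x + 1))
    (hall : ∀ x j, ∃ t < R, Z (j + t) = Z x)
    (hself : ∀ x x', Z x = Z x' → f (x + 1) - f x = f (x' + 1) - f x' ∧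
      ∀ r < f (x + 1) - f x, Z (f x + r) = Z (f x' + r)) :
    ∃ ζ : Substitution B, ζ.IsPrimitive ∧ ζ.fixedPoint = Z := by
  -- `g` picks a position carrying each letter; by `hself` the image of a letter does not depend on
  -- this choice.
  obtain ⟨g, hg⟩ := hZ.hasRightInverse
  let F : B → List B := fun b => seqFactor Z (f (g b)) (f (g b + 1) - f (g b))
  have hF : ∀ x, F (Z x) = seqFactor Z (f x) (f (x + 1) - f x) := fun x => by
    obtain ⟨h1, h2⟩ := hself _ _ (hg (Z x))
    simp only [F]
    rw [← h1, seqFactor_eq_iff]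
    exact h2
  have hword : ∀ l, wordMap F (seqFactor Z 0 l) = seqFactor Z 0 (f l) := fun l => by
    induction l with
    | zero => simp [f0, seqFactor, wordMap]
    | succ l ih =>
      rw [seqFactor_add, wordMap, List.flatMap_append, ← wordMap, ih]
      have h1 : List.flatMap F (seqFactor Z (0 + l) 1) = F (Z l) := by simp [seqFactor]
      have h2 : f (l + 1) = f l + (f (l + 1) - f l) := by have := hf l; omega
      rw [h1, hF, h2, seqFactor_add]
      simp
  have hlin : ∀ x, 2 * x ≤ f x := fun x => by
    induction x with
    | zero => simp
    | succ x ih => have := hf x; omega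
  have hpow : ∀ n, n < f^[n] 1 := fun n => by
    induction n with
    | zero => simp
    | succ n ih =>
      rw [Function.iterate_succ_apply']
      have := hlin (f^[n] 1)
      omega
  have hiter : ∀ n, (wordMap F)^[n] [Z 0] = seqFactor Z 0 (f^[n] 1) := fun n => by
    induction n with
    | zero => simp [seqFactor]
    | succ n ih => rw [Function.iterate_succ_apply', Function.iterate_succ_apply', ih, hword]
  have hlen : ∀ b, R ≤ (F b).length := fun b => by
    have := hf (g b)
    simp only [F, length_seqFactor]
    omega
  let ζ : Substitution B :=
    { toFun := F
      toFun_ne_nil := fun b h => by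
        have := hlen b
        simp [h] at this
        omega
      start := Z 0
      head_start := by
        rw [hF, f0]
        obtain ⟨m, hm⟩ : ∃ m, f (0 + 1) - 0 = m + 1 := by
          have := hf 0
          exact ⟨f (0 + 1) - 1, by omega⟩
        rw [hm]
        simp [seqFactor, List.range_succ_eq_map]
      tendsto_length := by
        simp only [hiter, length_seqFactor]
        exact Filter.tendsto_atTop_mono (fun n => (hpow n).le) Filter.tendsto_id }
  refine ⟨ζ, ⟨1, fun b c => ?_⟩, ?_⟩
  · have h1 : ζ.iter 1 b = F b := by simp [Substitution.iter, wordMap, ζ]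
    obtain ⟨x, rfl⟩ := hZ c
    obtain ⟨t, ht, htx⟩ := hall x (f (g b))
    rw [h1, ← htx]
    have := hf (g b)
    simp only [F, seqFactor, List.mem_map, List.mem_range]
    exact ⟨t, by omega, rfl⟩
  · funext n
    have h1 : seqFactor ζ.fixedPoint 0 (f^[n] 1) = seqFactor Z 0 (f^[n] 1) := by
      have h2 := ζ.iter_isSeqPrefix_fixedPoint n
      have h3 : ζ.iter n ζ.start = seqFactor Z 0 (f^[n] 1) := hiter n
      rwa [h3, IsSeqPrefix, OccursAt, length_seqFactor] at h2
    have h2 := getElem_seqFactor ζ.fixedPoint 0 (f^[n] 1) n (by simpa using hpow n)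
    have h3 := getElem_seqFactor Z 0 (f^[n] 1) n (by simpa using hpow n)
    simp only [h1, zero_add] at h2 h3
    exact h2.symm.trans h3

/-- Here `f x` is where the image of the letter at `x` starts. The values of `Y` may lie in any
universe, so they are renamed by `Fin N`. -/
theorem IsPrimitiveSubstitutive.of_selfSimilar {A C : Type*} {X : ℕ → A} (Y : ℕ → C)
    (hfin : (Set.range Y).Finite) (hXY : ∀ x x', Y x = Y x' → X x = X x')
    {f : ℕ → ℕ} {R : ℕ} (hR : 2 ≤ R) (f0 : f 0 = 0) (hf : ∀ x, f x + R ≤ f (x + 1))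
    (hall : ∀ x j, ∃ t < R, Y (j + t) = Y x)
    (hself : ∀ x x', Y x = Y x' → f (x + 1) - f x = f (x' + 1) - f x' ∧
      ∀ r < f (x + 1) - f x, Y (f x + r) = Y (f x' + r)) :
    IsPrimitiveSubstitutive X := by
  have := hfin.to_subtype
  obtain ⟨N, ⟨e⟩⟩ := Finite.exists_equiv_fin (Set.range Y)
  let Z : ℕ → Fin N := fun x => e ⟨Y x, x, rfl⟩
  have hZY : ∀ x x', Z x = Z x' ↔ Y x = Y x' := fun x x' =>
    e.injective.eq_iff.trans Subtype.mk_eq_mk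
  have hZ : Function.Surjective Z := fun b => by
    obtain ⟨x, hx⟩ := (e.symm b).2
    exact ⟨x, by simp [Z, hx]⟩
  obtain ⟨ζ, hζ, hfix⟩ := exists_primitive_fixedPoint Z hZ hR f0 hf
    (fun x j => by simpa only [hZY] using hall x j)
    (fun x x' h => by simpa only [hZY] using hself x x' ((hZY _ _).1 h))
  obtain ⟨g, hg⟩ := hZ.hasRightInverse
  refine ⟨Fin N, inferInstance, ζ, fun b => X (g b), hζ, funext fun x => ?_⟩
  rw [hfix]
  exact hXY _ _ ((hZY _ _).1 (hg (Z x)).symm)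

/-- The coding by residues modulo `p` is fixed by sending each residue to two full periods; two
rather than one keep the images of length at least 2 when `p = 1`. -/
theorem IsPrimitiveSubstitutive.of_periodic {A : Type*} {X : ℕ → A} {p : ℕ} (hp : 0 < p)
    (h : ∀ x, X (x + p) = X x) : IsPrimitiveSubstitutive X := by
  have hmul : ∀ q x, X (x + p * q) = X x := fun q x => by
    induction q with
    | zero => simp
    | succ q ih => rw [Nat.mul_succ, ← add_assoc, h, ih]
  refine IsPrimitiveSubstitutive.of_selfSimilar (fun x => x % p) ?_ (fun x x' hx => ?_)
    (f := fun x => 2 * p * x) (R := 2 * p) (by omega) (by simp) (fun x => by simp [mul_add])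
    (fun x j => ?_) (fun x x' _ => ?_)
  · refine (Set.finite_Iio p).subset ?_
    rintro _ ⟨x, rfl⟩
    exact Nat.mod_lt _ hp
  · replace hx : x % p = x' % p := hx
    rw [← Nat.mod_add_div x p, ← Nat.mod_add_div x' p, hmul, hmul, hx]
  · have hj := Nat.mod_lt j hp
    refine ⟨(x + (p - j % p)) % p, by have := Nat.mod_lt (x + (p - j % p)) hp; omega, ?_⟩
    have key : j + (x + (p - j % p)) = x + p * (j / p + 1) := by
      have := Nat.mod_add_div j p
      rw [mul_add]
      omega
    rw [Nat.add_mod_mod, key, Nat.add_mul_mod_self_left]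
  · refine ⟨by simp [mul_add], fun r _ => ?_⟩
    have h1 : ∀ y, 2 * p * y + r = r + p * (2 * y) := fun y => by ring
    simp only [h1, Nat.add_mul_mod_self_left]

end SelfSimilar

/-! ### Gaps between occurrences -/

section Gaps

variable {A : Type*} {X : ℕ → A}

theorem exists_block {e : ℕ → ℕ} (he : StrictMono e) (h0 : e 0 = 0) (x : ℕ) :
    ∃ k, e k ≤ x ∧ x < e (k + 1) := by
  induction x with
  | zero => exact ⟨0, h0.le, by simpa [h0] using he (Nat.lt_succ_self 0)⟩
  | succ x ih =>
    obtain ⟨k, hk, hk'⟩ := ih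
    rcases Nat.lt_or_ge (x + 1) (e (k + 1)) with h | h
    · exact ⟨k, by omega, h⟩
    · exact ⟨k + 1, h, by have := he (Nat.lt_add_one (k + 1)); omega⟩

theorem block_unique {e : ℕ → ℕ} (he : StrictMono e) {x k k' : ℕ} (h1 : e k ≤ x)
    (h2 : x < e (k + 1)) (h3 : e k' ≤ x) (h4 : x < e (k' + 1)) : k = k' := by
  have h5 := he.lt_iff_lt.1 (h1.trans_lt h4)
  have h6 := he.lt_iff_lt.1 (h3.trans_lt h2)
  omega

/-- In a sequence without periods, long prefixes have only long return words. -/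
theorem exists_long_gaps (hX : ¬ ∃ p, 0 < p ∧ ∀ x, X (x + p) = X x) (G : ℕ) :
    ∃ N, ∀ n, N ≤ n → ∀ i j, i < j → OccursAt X (seqFactor X 0 n) i →
      OccursAt X (seqFactor X 0 n) j → i + G < j := by
  push Not at hX
  choose! y hy using hX
  -- `y p` witnesses that `p` is not a period. A prefix this long contains the witnesses for all `p
  -- ≤ G`, so it cannot recur at distance `p`.
  refine ⟨(Finset.range (G + 1)).sup y + G + 1, fun n hn i j hij hi hj => ?_⟩
  by_contra! hG
  rw [occursAt_prefix_iff] at hi hj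
  have h1 : y (j - i) ≤ (Finset.range (G + 1)).sup y :=
    Finset.le_sup (f := y) (by simp; omega)
  refine hy (j - i) (by omega) ?_
  rw [← hi _ (by omega), ← hj (y (j - i)) (by omega)]
  congr 1
  omega

theorem infinite_occursAt_prefix (hX : IsMinimalSeq X) (n : ℕ) :
    (Set.ofPred (OccursAt X (seqFactor X 0 n))).Infinite := by
  obtain ⟨G, hG⟩ := hX.exists_gap n
  refine Set.infinite_of_not_bddAbove fun ⟨b, hb⟩ => ?_
  obtain ⟨j, hj, -, hP⟩ := hG b
  have := hb hP
  omega

end Gaps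

/-! ### Coding by pieces and offsets -/

section ReturnCoding

variable {A : Type*} {X : ℕ → A} {P : ℕ → Prop}

open Classical in
/-- The coding of the sequence `X`, cut at the positions satisfying `P`: the letter at `x` is the
piece containing `x`, together with the offset of `x` in this piece. -/
noncomputable def pieceCoding (X : ℕ → A) (P : ℕ → Prop) (x : ℕ) : List A × ℕ :=
  (seqFactor X (Nat.findGreatest P x) (sInf {y | x < y ∧ P y} - Nat.findGreatest P x),
    x - Nat.findGreatest P x)

/-- `z` and `w` are consecutive positions satisfying `P`. -/
def IsGap (P : ℕ → Prop) (z w : ℕ) : Prop :=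
  P z ∧ P w ∧ ∀ y, z < y → y < w → ¬ P y

theorem pieceCoding_eq {z w x : ℕ} (h : IsGap P z w) (hz : z ≤ x) (hw : x < w) :
    pieceCoding X P x = (seqFactor X z (w - z), x - z) := by
  classical
  obtain ⟨hPz, hPw, hn⟩ := h
  have h1 : Nat.findGreatest P x = z := by
    rw [Nat.findGreatest_eq_iff]
    exact ⟨hz, fun _ => hPz, fun n h1 h2 => hn n h1 (by omega)⟩
  have h2 : sInf {y | x < y ∧ P y} = w := by
    refine le_antisymm (Nat.sInf_le ⟨hw, hPw⟩) ?_
    obtain ⟨h3, h4⟩ := Nat.sInf_mem (s := {y | x < y ∧ P y}) ⟨w, hw, hPw⟩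
    by_contra! h5
    exact hn _ (by omega) h5 h4
  simp only [pieceCoding]
  rw [h2, show Nat.findGreatest P x = z by convert h1]

theorem isGap_nth (hP : (Set.ofPred P).Infinite) (k : ℕ) :
    IsGap P (Nat.nth P k) (Nat.nth P (k + 1)) :=
  ⟨Nat.nth_mem_of_infinite hP k, Nat.nth_mem_of_infinite hP (k + 1), fun y h1 h2 h3 => by
    have := Nat.le_nth_of_lt_nth_succ h2 h3
    omega⟩

theorem exists_isGap (hP : (Set.ofPred P).Infinite) (h0 : P 0) (x : ℕ) :
    ∃ z w, z ≤ x ∧ x < w ∧ IsGap P z w := by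
  obtain ⟨k, h1, h2⟩ := exists_block (Nat.nth_strictMono hP) (Nat.nth_zero_of_zero h0) x
  exact ⟨_, _, h1, h2, isGap_nth hP k⟩

/-- Both ends of the interval are cuts, so every piece meeting it lies inside, and the coding there
sees nothing outside. -/
theorem pieceCoding_congr (hP : (Set.ofPred P).Infinite) (h0 : P 0) {a a' l : ℕ} (ha : P a)
    (hl : P (a + l)) (hPP : ∀ r ≤ l, P (a + r) ↔ P (a' + r))
    (hX : ∀ r < l, X (a + r) = X (a' + r)) {r : ℕ} (hr : r < l) :
    pieceCoding X P (a + r) = pieceCoding X P (a' + r) := by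
  obtain ⟨z, w, hz, hw, hg⟩ := exists_isGap hP h0 (a + r)
  have haz : a ≤ z := by
    by_contra! h
    exact hg.2.2 a h (by omega) ha
  have hwl : w ≤ a + l := by
    by_contra! h
    exact hg.2.2 (a + l) (by omega) h hl
  obtain ⟨i, rfl⟩ := Nat.exists_eq_add_of_le haz
  obtain ⟨j, rfl⟩ : ∃ j, w = a + j := ⟨w - a, by omega⟩
  have hg' : IsGap P (a' + i) (a' + j) := by
    refine ⟨(hPP i (by omega)).1 hg.1, (hPP j (by omega)).1 hg.2.1, fun y h1 h2 h3 => ?_⟩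
    obtain ⟨m, rfl⟩ : ∃ m, y = a' + m := ⟨y - a', by omega⟩
    exact hg.2.2 (a + m) (by omega) (by omega) ((hPP m (by omega)).2 h3)
  rw [pieceCoding_eq hg hz hw, pieceCoding_eq hg' (by omega) (by omega)]
  rw [show a + j - (a + i) = j - i by omega, show a' + j - (a' + i) = j - i by omega,
    show a + r - (a + i) = a' + r - (a' + i) by omega]
  congr 1
  rw [seqFactor_eq_iff]
  intro s hs
  rw [add_assoc, add_assoc]
  exact hX _ (by omega)

end ReturnCoding

/-! ### From finitely many derived sequences to a substitution -/

section Recoding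

/-- A map between positions that sends the `k`-th block of one partition to the `k`-th block of
another, in steps of length at least `R`. -/
theorem exists_block_map {e e' : ℕ → ℕ} (he : StrictMono e) (h0 : e 0 = 0) (R : ℕ) :
    ∃ f : ℕ → ℕ, ∀ k x, e k ≤ x → x < e (k + 1) → f x = e' k + (x - e k) * R := by
  choose κ h1 h2 using exists_block he h0
  refine ⟨fun x => e' (κ x) + (x - e (κ x)) * R, fun k x hk hk' => ?_⟩
  beta_reduce
  rw [block_unique he (h1 x) (h2 x) hk hk']

/-- Pigeonhole: infinitely many prefix lengths and finitely many values force an infinite fibre. -/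
theorem exists_repeated_derivedSeq {A : Type*} {X : ℕ → A} (h : (derivedSeqs X).Finite) :
    ∃ m, 1 ≤ m ∧ ∀ N, ∃ n, N ≤ n ∧
      derivedSeq X (seqFactor X 0 m) = derivedSeq X (seqFactor X 0 n) := by
  rw [derivedSeqs_eq_image] at h
  by_contra! hc
  refine (Set.infinite_of_not_bddAbove ?_ : {n : ℕ | 1 ≤ n}.Infinite)
    (Set.Finite.of_finite_fibers _ h ?_)
  · rintro ⟨b, hb⟩
    have : b + 1 ≤ b := hb (by simp)
    omega
  · rintro _ ⟨m, hm, rfl⟩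
    obtain ⟨N, hN⟩ := hc m hm
    refine (Set.finite_Iio N).subset fun n hn => ?_
    by_contra! hlt
    exact hN n (by simpa using hlt) hn.2.symm

theorem IsMinimalSeq.isPrimitiveSubstitutive_of_not_periodic {A : Type*} [Finite A] {X : ℕ → A}
    (hX : IsMinimalSeq X) (hper : ¬ ∃ p, 0 < p ∧ ∀ x, X (x + p) = X x)
    (hfin : (derivedSeqs X).Finite) : IsPrimitiveSubstitutive X := by
  obtain ⟨m, hm, hrep⟩ := exists_repeated_derivedSeq hfin
  obtain ⟨G, hG⟩ := hX.exists_gap m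
  -- A return word over `u` has length at most `G`; the `m` further letters decide all occurrences
  -- of `u` up to its right end, so a copy of this factor reproduces the coded letters.
  obtain ⟨R₀, hR₀⟩ := hX (G + m)
  set R := R₀ + 2 with hR
  -- This leaves room for `R` letters of the return word over `v` for each letter of the one over
  -- `u`.
  obtain ⟨N, hN⟩ := exists_long_gaps hper (R * (G + 1))
  obtain ⟨n, hn, hD⟩ := hrep (max N m)
  have hword : ∀ k k', returnWord X (seqFactor X 0 m) k = returnWord X (seqFactor X 0 m) k' →
      returnWord X (seqFactor X 0 n) k = returnWord X (seqFactor X 0 n) k' := fun k k' hk =>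
    returnWord_eq_of_derivedSeq_eq (by rw [← hD, derivedSeq, derivedSeq, hk])
  set u := seqFactor X 0 m with hu
  set v := seqFactor X 0 n with hv
  have hPinf : (Set.ofPred (OccursAt X u)).Infinite := infinite_occursAt_prefix hX m
  have hQinf : (Set.ofPred (OccursAt X v)).Infinite := infinite_occursAt_prefix hX n
  have hP0 : OccursAt X u 0 := occursAt_prefix_zero X m
  have hQ0 : OccursAt X v 0 := occursAt_prefix_zero X n
  have hPiff : ∀ i, OccursAt X u i ↔ ∀ r < m, X (i + r) = X r := fun i => occursAt_prefix_iff
  have hQiff : ∀ i, OccursAt X v i ↔ ∀ r < n, X (i + r) = X r := fun i => occursAt_prefix_iff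
  have hQP : ∀ i, OccursAt X v i → OccursAt X u i := fun i h =>
    (hPiff i).2 fun r hr => (hQiff i).1 h r (by omega)
  have hPcongr : ∀ a a' l, (∀ r < l + m, X (a + r) = X (a' + r)) →
      ∀ r ≤ l, OccursAt X u (a + r) ↔ OccursAt X u (a' + r) := fun a a' l h r hr => by
    rw [hPiff, hPiff]
    refine forall₂_congr fun s hs => ?_
    rw [add_assoc, add_assoc, h _ (by omega)]
  set e := occurrence X u with he_def
  set e' := occurrence X v with he'_def
  have he : StrictMono e := Nat.nth_strictMono hPinf
  have he' : StrictMono e' := Nat.nth_strictMono hQinf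
  have he0 : e 0 = 0 := Nat.nth_zero_of_zero hP0
  have he'0 : e' 0 = 0 := Nat.nth_zero_of_zero hQ0
  have hgap : ∀ k, IsGap (OccursAt X u) (e k) (e (k + 1)) := fun k => isGap_nth hPinf k
  have hgap' : ∀ k, IsGap (OccursAt X v) (e' k) (e' (k + 1)) := fun k => isGap_nth hQinf k
  have hlen : ∀ k, e (k + 1) ≤ e k + G := fun k => by
    obtain ⟨j, hj1, hj2, hj3⟩ := hG (e k)
    by_contra! h
    exact (hgap k).2.2 j hj1 (by omega) hj3
  have hlen' : ∀ k, e' k + R * (G + 1) < e' (k + 1) := fun k =>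
    hN n (by omega) _ _ (he' (Nat.lt_add_one k)) (hgap' k).1 (hgap' k).2.1
  have hmono : ∀ k, e k < e (k + 1) := fun k => he (Nat.lt_add_one k)
  set Y := pieceCoding X (OccursAt X u) with hY
  have hYe : ∀ k x, e k ≤ x → x < e (k + 1) → Y x = (returnWord X u k, x - e k) :=
    fun k x h1 h2 => pieceCoding_eq (hgap k) h1 h2
  -- Within a return word every letter but the last receives exactly `R` letters; the last one
  -- absorbs the remainder.
  obtain ⟨f, hf⟩ := exists_block_map (e' := e') he he0 R
  have hf' : ∀ k, f (e k) = e' k := fun k => by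
    rw [hf k _ le_rfl (hmono k)]
    simp
  have hfsucc : ∀ k x, e k ≤ x → x < e (k + 1) →
      f (x + 1) = if x + 1 < e (k + 1) then f x + R else e' (k + 1) := fun k x h1 h2 => by
    split_ifs with h
    · rw [hf k _ h1 h2, hf k _ (by omega) h, show x + 1 - e k = x - e k + 1 by omega]
      ring
    · rw [show x + 1 = e (k + 1) by omega, hf']
  have hfle : ∀ k x, e k ≤ x → x < e (k + 1) → f x + R ≤ e' (k + 1) := fun k x h1 h2 => by
    rw [hf k x h1 h2]
    have h3 : (x - e k + 1) * R ≤ (G + 1) * R :=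
      Nat.mul_le_mul_right R (by have := hlen k; omega)
    have := hlen' k
    rw [mul_comm] at h3
    nlinarith
  refine IsPrimitiveSubstitutive.of_selfSimilar Y ?_ ?_ (f := f) (R := R) (by omega) ?_ ?_ ?_ ?_
  · refine ((List.finite_length_le A G).prod (Set.finite_Iio G)).subset ?_
    rintro _ ⟨x, rfl⟩
    obtain ⟨k, h1, h2⟩ := exists_block he he0 x
    rw [hYe k x h1 h2]
    have := hlen k
    refine ⟨?_, ?_⟩
    · change (returnWord X u k).length ≤ G
      simp only [returnWord, length_seqFactor, ← he_def]
      omega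
    · change x - e k < G
      omega
  · intro x x' hxx
    obtain ⟨k, h1, h2⟩ := exists_block he he0 x
    obtain ⟨k', h1', h2'⟩ := exists_block he he0 x'
    rw [hYe k x h1 h2, hYe k' x' h1' h2', Prod.mk.injEq] at hxx
    have hl := congrArg List.length hxx.1
    simp only [returnWord, length_seqFactor, ← he_def] at hl
    have hw := hxx.1
    simp only [returnWord, ← he_def] at hw
    rw [← hl, seqFactor_eq_iff] at hw
    have := hw (x - e k) (by omega)
    rwa [show e k + (x - e k) = x by omega, show e k' + (x - e k) = x' by omega] at this
  · rw [← he0, hf', he'0]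
    exact he0.symm
  · intro x
    obtain ⟨k, h1, h2⟩ := exists_block he he0 x
    rw [hfsucc k x h1 h2]
    split_ifs with h
    · exact le_rfl
    · exact hfle k x h1 h2
  · intro x j
    obtain ⟨k, h1, h2⟩ := exists_block he he0 x
    obtain ⟨t, ht, hagree⟩ := exists_offset_of_infix (hR₀ (e k) j)
    have hl := hlen k
    refine ⟨t + (x - e k), by omega, ?_⟩
    have hPe := hPcongr (e k) (j + t) G fun r hr => hagree r hr
    have := pieceCoding_congr (X := X) hPinf hP0 (a := e k) (a' := j + t) (l := e (k + 1) - e k)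
      (hgap k).1 (by rw [show e k + (e (k + 1) - e k) = e (k + 1) by omega]; exact (hgap k).2.1)
      (fun r hr => hPe r (by omega)) (fun r hr => hagree r (by omega))
      (r := x - e k) (by omega)
    rw [show e k + (x - e k) = x by omega] at this
    rw [← add_assoc]
    exact this.symm
  · intro x x' hxx
    obtain ⟨k, h1, h2⟩ := exists_block he he0 x
    obtain ⟨k', h1', h2'⟩ := exists_block he he0 x'
    rw [hYe k x h1 h2, hYe k' x' h1' h2', Prod.mk.injEq] at hxx
    have hl := congrArg List.length hxx.1
    simp only [returnWord, length_seqFactor, ← he_def] at hl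
    have hw := hword k k' hxx.1
    have hl' := congrArg List.length hw
    simp only [returnWord, length_seqFactor, ← he'_def] at hl' hw
    rw [← hl', seqFactor_eq_iff] at hw
    have h3 := hlen' k
    have h3' := hlen' k'
    -- Both return words are followed by `v`, so agreement extends by `n` letters. As `m ≤ n`, this
    -- fixes the occurrences of `u`, hence the coding, on the whole return word.
    have hagree : ∀ r < e' (k + 1) - e' k + n, X (e' k + r) = X (e' k' + r) := fun r hr => by
      rcases Nat.lt_or_ge r (e' (k + 1) - e' k) with h | h
      · exact hw r h
      · obtain ⟨s, rfl⟩ := Nat.exists_eq_add_of_le h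
        have h4 := (hQiff _).1 (hgap' k).2.1 s (by omega)
        have h5 := (hQiff _).1 (hgap' k').2.1 s (by omega)
        rw [show e' k + (e' (k + 1) - e' k + s) = e' (k + 1) + s by omega,
          show e' k' + (e' (k + 1) - e' k + s) = e' (k' + 1) + s by omega, h4, h5]
    have hPe := hPcongr (e' k) (e' k') (e' (k + 1) - e' k) fun r hr => hagree r (by omega)
    have hYY : ∀ r < e' (k + 1) - e' k, Y (e' k + r) = Y (e' k' + r) := fun r hr =>
      pieceCoding_congr (X := X) hPinf hP0 (hQP _ (hgap' k).1)
        (by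
          rw [show e' k + (e' (k + 1) - e' k) = e' (k + 1) by omega]
          exact hQP _ (hgap' k).2.1)
        hPe (fun r hr => hagree r (by omega)) hr
    have hfx := hf k x h1 h2
    have hfx' := hf k' x' h1' h2'
    have hs := hfsucc k x h1 h2
    have hs' := hfsucc k' x' h1' h2'
    have hle := hfle k x h1 h2
    rw [← hxx.2] at hfx'
    set c := (x - e k) * R
    have hiff : x + 1 < e (k + 1) ↔ x' + 1 < e (k' + 1) := by omega
    have hsub : f (x + 1) - f x = f (x' + 1) - f x' ∧ f (x + 1) ≤ e' (k + 1) := by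
      rw [hs, hs']
      simp only [hiff]
      split_ifs <;> omega
    refine ⟨hsub.1, fun r hr => ?_⟩
    have := hYY (c + r) (by omega)
    rwa [hfx, hfx', add_assoc, add_assoc]

theorem IsMinimalSeq.isPrimitiveSubstitutive {A : Type*} [Finite A] {X : ℕ → A}
    (hX : IsMinimalSeq X) (hfin : (derivedSeqs X).Finite) : IsPrimitiveSubstitutive X := by
  by_cases hper : ∃ p, 0 < p ∧ ∀ x, X (x + p) = X x
  · obtain ⟨p, hp, h⟩ := hper
    exact .of_periodic hp h
  · exact hX.isPrimitiveSubstitutive_of_not_periodic hper hfin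

end Recoding

/-! ### Iterated images of the fixed point -/

section Words

variable {B : Type*}

theorem infix_wordMap {C : Type*} (f : B → List C) {b : B} {w : List B} (h : b ∈ w) :
    f b <:+: wordMap f w := by
  obtain ⟨s, t, rfl⟩ := List.mem_iff_append.1 h
  exact ⟨wordMap f s, wordMap f t, by simp [wordMap]⟩

theorem length_wordMap_le {C : Type*} (f : B → List C) {m : ℕ} {w : List B}
    (h : ∀ b ∈ w, (f b).length ≤ m) : (wordMap f w).length ≤ w.length * m := by
  induction w with
  | nil => simp [wordMap]
  | cons b w ih =>
    simp only [List.mem_cons, forall_eq_or_imp] at h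
    have h1 := ih h.2
    have h2 : wordMap f (b :: w) = f b ++ wordMap f w := rfl
    rw [h2, List.length_append, List.length_cons, add_mul, one_mul, add_comm]
    exact Nat.add_le_add h1 h.1

namespace Substitution

variable (ζ : Substitution B)

theorem iterate_wordMap (p : ℕ) (w : List B) :
    (wordMap ζ.toFun)^[p] w = wordMap (ζ.iter p) w := by
  have happ : ∀ s t : List B, (wordMap ζ.toFun)^[p] (s ++ t) =
      (wordMap ζ.toFun)^[p] s ++ (wordMap ζ.toFun)^[p] t := by
    induction p with
    | zero => simp
    | succ p ih =>
      intro s t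
      have : wordMap ζ.toFun (s ++ t) = wordMap ζ.toFun s ++ wordMap ζ.toFun t := by
        simp [wordMap]
      rw [Function.iterate_succ_apply, this, ih, Function.iterate_succ_apply,
        Function.iterate_succ_apply]
  induction w with
  | nil =>
    have := congrArg List.length (happ [] [])
    simp only [List.append_nil, List.length_append] at this
    exact List.length_eq_zero_iff.1 (by omega)
  | cons b w ih =>
    rw [← List.singleton_append, happ, ih]
    simp [wordMap, iter]

theorem iter_add (p q : ℕ) (b : B) : ζ.iter (p + q) b = wordMap (ζ.iter p) (ζ.iter q b) := by
  rw [← iterate_wordMap, iter, iter, Function.iterate_add_apply]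

theorem length_iter_pos (p : ℕ) (b : B) : 0 < (ζ.iter p b).length := by
  induction p with
  | zero => simp [iter]
  | succ p ih =>
    rw [add_comm, iter_add]
    obtain ⟨c, hc⟩ := List.exists_mem_of_length_pos ih
    have h1 := (infix_wordMap (ζ.iter 1) hc).length_le
    have h2 := List.length_pos_iff.2 (ζ.toFun_ne_nil c)
    have h3 : ζ.iter 1 c = ζ.toFun c := by simp [iter, wordMap]
    rw [h3] at h1
    omega

/-- The position in the fixed point of the `p`-th iterated image of the letter of index `k`. -/
noncomputable def cut (p k : ℕ) : ℕ :=
  (wordMap (ζ.iter p) (seqFactor ζ.fixedPoint 0 k)).length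

theorem cut_zero (p : ℕ) : ζ.cut p 0 = 0 := by
  simp [cut, seqFactor, wordMap]

theorem wordMap_prefix_succ (p k : ℕ) : wordMap (ζ.iter p) (seqFactor ζ.fixedPoint 0 (k + 1)) =
    wordMap (ζ.iter p) (seqFactor ζ.fixedPoint 0 k) ++ ζ.iter p (ζ.fixedPoint k) := by
  simp [wordMap, seqFactor, List.range_succ]

theorem cut_succ (p k : ℕ) :
    ζ.cut p (k + 1) = ζ.cut p k + (ζ.iter p (ζ.fixedPoint k)).length := by
  rw [cut, wordMap_prefix_succ, List.length_append, ← cut]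

theorem cut_strictMono (p : ℕ) : StrictMono (ζ.cut p) :=
  strictMono_nat_of_lt_succ fun k => by
    rw [cut_succ]
    have := ζ.length_iter_pos p (ζ.fixedPoint k)
    omega

theorem seqFactor_eq_of_prefix {w : List B} (h : IsSeqPrefix w ζ.fixedPoint) {n : ℕ}
    (hn : n ≤ w.length) : seqFactor ζ.fixedPoint 0 n <+: w := by
  rw [IsSeqPrefix, OccursAt] at h
  obtain ⟨m, hm⟩ := Nat.exists_eq_add_of_le hn
  rw [← h, hm, seqFactor_add]
  exact List.prefix_append _ _

/-- A prefix of the fixed point is a prefix of some `ζ.iter i ζ.start`, so its image is a prefix of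
`ζ.iter (p + i) ζ.start`. -/
theorem seqFactor_cut_zero (p k : ℕ) : seqFactor ζ.fixedPoint 0 (ζ.cut p k) =
    wordMap (ζ.iter p) (seqFactor ζ.fixedPoint 0 k) := by
  obtain ⟨i, hi⟩ := ζ.exists_lt_length k
  obtain ⟨t, ht⟩ := ζ.seqFactor_eq_of_prefix (ζ.iter_isSeqPrefix_fixedPoint i) hi.le
  have h1 : wordMap (ζ.iter p) (seqFactor ζ.fixedPoint 0 k) <+: ζ.iter (p + i) ζ.start := by
    rw [iter_add, ← ht]
    exact ⟨wordMap (ζ.iter p) t, by simp [wordMap]⟩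
  have h2 := ζ.seqFactor_eq_of_prefix (ζ.iter_isSeqPrefix_fixedPoint (p + i)) h1.length_le
  exact (List.prefix_of_prefix_length_le h2 h1 (by simp)).eq_of_length (length_seqFactor ..)

theorem seqFactor_cut (p k : ℕ) :
    seqFactor ζ.fixedPoint (ζ.cut p k) (ζ.iter p (ζ.fixedPoint k)).length =
      ζ.iter p (ζ.fixedPoint k) := by
  have h1 := ζ.seqFactor_cut_zero p (k + 1)
  rw [wordMap_prefix_succ, cut_succ, seqFactor_add, ← seqFactor_cut_zero, zero_add] at h1
  exact List.append_cancel_left h1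

/-- Equal factors of the fixed point have equal iterated images. -/
theorem cut_congr (p : ℕ) {k k' l : ℕ}
    (h : ∀ r < l, ζ.fixedPoint (k + r) = ζ.fixedPoint (k' + r)) :
    (∀ j ≤ l, ζ.cut p (k + j) + ζ.cut p k' = ζ.cut p (k' + j) + ζ.cut p k) ∧
      ∀ r, ζ.cut p k + r < ζ.cut p (k + l) →
        ζ.fixedPoint (ζ.cut p k + r) = ζ.fixedPoint (ζ.cut p k' + r) := by
  induction l with
  | zero => exact ⟨fun j hj => by obtain rfl : j = 0 := by omega
                                  simp [add_comm], fun r hr => by simp at hr⟩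
  | succ l ih =>
    obtain ⟨ih1, ih2⟩ := ih fun r hr => h r (by omega)
    have hl := h l (by omega)
    have e1 := ζ.cut_succ p (k + l)
    have e2 := ζ.cut_succ p (k' + l)
    have e3 := ih1 l le_rfl
    have m1 := (ζ.cut_strictMono p).monotone (Nat.le_add_right k l)
    have m2 := (ζ.cut_strictMono p).monotone (Nat.le_add_right k' l)
    rw [← hl] at e2
    refine ⟨fun j hj => ?_, fun r hr => ?_⟩
    · rcases Nat.lt_or_ge j (l + 1) with hj' | hj'
      · exact ih1 j (by omega)
      · obtain rfl : j = l + 1 := by omega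
        rw [← add_assoc, ← add_assoc, e1, e2]
        omega
    · rcases Nat.lt_or_ge (ζ.cut p k + r) (ζ.cut p (k + l)) with hr' | hr'
      · exact ih2 r hr'
      · obtain ⟨s, hs⟩ := Nat.exists_eq_add_of_le hr'
        have hs' : ζ.cut p k' + r = ζ.cut p (k' + l) + s := by omega
        rw [← add_assoc, e1] at hr
        have f1 := ζ.seqFactor_cut p (k + l)
        have f2 := ζ.seqFactor_cut p (k' + l)
        rw [← hl, ← f1, length_seqFactor, seqFactor_eq_iff] at f2
        rw [hs, hs']
        exact (f2 s (by omega)).symm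

theorem exists_block_cut (p j : ℕ) :
    ∃ k, ζ.cut p k ≤ j ∧ j < ζ.cut p (k + 1) :=
  exists_block (ζ.cut_strictMono p) (ζ.cut_zero p) j

variable {ζ} in
theorem cut_add_le {p m : ℕ} (h : ∀ b, (ζ.iter p b).length ≤ m) (k l : ℕ) :
    ζ.cut p (k + l) ≤ ζ.cut p k + l * m := by
  induction l with
  | zero => simp
  | succ l ih =>
    rw [← add_assoc, ζ.cut_succ, add_mul]
    have := h (ζ.fixedPoint (k + l))
    omega

variable {ζ} in
theorem le_cut_add {p m : ℕ} (h : ∀ b, m ≤ (ζ.iter p b).length) (k l : ℕ) :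
    ζ.cut p k + l * m ≤ ζ.cut p (k + l) := by
  induction l with
  | zero => simp
  | succ l ih =>
    rw [← add_assoc, ζ.cut_succ, add_mul]
    have := h (ζ.fixedPoint (k + l))
    omega

end Substitution

end Words

/-! ### Linear recurrence for primitive substitutions -/

namespace Substitution.IsPrimitive

variable {B : Type*} [Finite B] {ζ : Substitution B}

theorem exists_length_le (ζ : Substitution B) (k : ℕ) :
    ∃ C, ∀ j ≤ k, ∀ b, (ζ.iter j b).length ≤ C := by
  obtain ⟨C, hC⟩ := (Set.finite_range
    (fun x : Fin (k + 1) × B => (ζ.iter x.1 x.2).length)).bddAbove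
  exact ⟨C, fun j hj b => hC ⟨(⟨j, by omega⟩, b), rfl⟩⟩

/-- If `p = q + k` with `k` the primitivity exponent, every letter `d` occurs in `ζ.iter k c`, so
`ζ.iter q d` is no longer than `ζ.iter p c`, while `ζ.iter p b` is a product of boundedly many such
words. -/
theorem exists_length_le_mul (h : ζ.IsPrimitive) :
    ∃ C, ∀ p b c, (ζ.iter p b).length ≤ C * (ζ.iter p c).length := by
  obtain ⟨k, hk⟩ := h
  obtain ⟨C, hC⟩ := exists_length_le ζ k
  refine ⟨C, fun p b c => ?_⟩
  rcases Nat.lt_or_ge p k with hp | hp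
  · exact (hC p hp.le b).trans (Nat.le_mul_of_pos_right C (ζ.length_iter_pos p c))
  · obtain ⟨q, rfl⟩ : ∃ q, p = q + k := ⟨p - k, by omega⟩
    rw [ζ.iter_add q k b]
    refine (length_wordMap_le _ (m := (ζ.iter (q + k) c).length) fun d _ => ?_).trans
      (Nat.mul_le_mul_right _ (hC k le_rfl b))
    rw [ζ.iter_add q k c]
    exact (infix_wordMap _ (hk c d)).length_le

/-- At every scale `n` there is an iterate all of whose images of letters have lengths comparable
to `n`. -/
theorem exists_scale (h : ζ.IsPrimitive) : ∃ C, ∀ n, 1 ≤ n → ∃ p, ∀ b,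
    n ≤ (ζ.iter p b).length ∧ (ζ.iter p b).length ≤ C * n := by
  obtain ⟨C, hC⟩ := h.exists_length_le_mul
  obtain ⟨M, hM⟩ := exists_length_le ζ 1
  refine ⟨M * C + 1, fun n hn => ?_⟩
  have hex : ∃ p, ∀ b, n ≤ (ζ.iter p b).length := by
    obtain ⟨p, hp⟩ := ζ.exists_lt_length (C * n)
    refine ⟨p, fun b => ?_⟩
    exact (Nat.lt_of_mul_lt_mul_left (hp.trans_le (hC p _ b))).le
  classical
  -- For the least such exponent, the preceding iterate has an image shorter than `n`, so all its
  -- images are at most `C * n`; one more application costs a factor `M`. The `+ 1` in the constant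
  -- covers exponent 0.
  refine ⟨Nat.find hex, fun b => ⟨Nat.find_spec hex b, ?_⟩⟩
  rcases hp : Nat.find hex with _ | p
  · simp only [iter, Function.iterate_zero, id, List.length_singleton]
    nlinarith [Nat.zero_le (M * C * n)]
  · have hmin := Nat.find_min hex (m := p) (by omega)
    push Not at hmin
    obtain ⟨c, hc⟩ := hmin
    rw [ζ.iter_add p 1 b]
    have h1 : (wordMap (ζ.iter p) (ζ.iter 1 b)).length ≤ (ζ.iter 1 b).length * (C * n) :=
      length_wordMap_le _ fun d _ => (hC p d c).trans (Nat.mul_le_mul_left C hc.le)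
    have h2 := Nat.mul_le_mul_right (C * n) (hM 1 le_rfl b)
    nlinarith

/-- All factors of length `l` occur in one `ζ.iter n ζ.start`, hence in the image of every letter
under the iterate `n + q`; a window of length `2 * G` contains such an image entirely. -/
theorem isMinimalSeq_fixedPoint (h : ζ.IsPrimitive) : IsMinimalSeq ζ.fixedPoint := by
  intro l
  obtain ⟨q, hq⟩ := h
  have hfin : (Set.range fun i => seqFactor ζ.fixedPoint i l).Finite :=
    (List.finite_length_eq B l).subset (by rintro _ ⟨i, rfl⟩; simp)
  have hI : ∃ I, ∀ i, ∃ i' ≤ I, seqFactor ζ.fixedPoint i' l = seqFactor ζ.fixedPoint i l := by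
    choose! g hg using fun (w : List B) (hw : w ∈ Set.range fun i => seqFactor ζ.fixedPoint i l) =>
      hw
    obtain ⟨I, hI⟩ := (hfin.image g).bddAbove
    exact ⟨I, fun i => ⟨g (seqFactor ζ.fixedPoint i l), hI ⟨_, ⟨i, rfl⟩, rfl⟩, hg _ ⟨i, rfl⟩⟩⟩
  obtain ⟨I, hI⟩ := hI
  obtain ⟨n, hn⟩ := ζ.exists_lt_length (I + l)
  obtain ⟨G, hG⟩ := exists_length_le ζ (n + q)
  refine ⟨2 * G, fun i j => ?_⟩
  obtain ⟨i', hi', he⟩ := hI i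
  rw [← he]
  obtain ⟨k, hk, hk'⟩ := ζ.exists_block_cut (n + q) j
  have h1 : seqFactor ζ.fixedPoint i' l <:+: seqFactor ζ.fixedPoint 0 (I + l) :=
    seqFactor_infix (by omega) (by omega)
  have h2 := ζ.seqFactor_eq_of_prefix (ζ.iter_isSeqPrefix_fixedPoint n) hn.le
  have h3 : ζ.iter n ζ.start <:+: ζ.iter (n + q) (ζ.fixedPoint (k + 1)) := by
    rw [ζ.iter_add]
    exact infix_wordMap _ (hq _ _)
  refine (h1.trans h2.isInfix).trans (h3.trans ?_)
  rw [← ζ.seqFactor_cut (n + q) (k + 1)]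
  have h4 := ζ.cut_succ (n + q) k
  have h5 := hG _ le_rfl (ζ.fixedPoint k)
  have h6 := hG _ le_rfl (ζ.fixedPoint (k + 1))
  exact seqFactor_infix (by omega) (by omega)

/-- Fixed points of primitive substitutions are linearly recurrent. -/
theorem exists_linear_recurrence (h : ζ.IsPrimitive) : ∃ K, ∀ n, 1 ≤ n → ∀ i j,
    ∃ t, t + n ≤ K * n ∧ ∀ r < n, ζ.fixedPoint (i + r) = ζ.fixedPoint (j + t + r) := by
  -- Blocks have length at least `n`, so a factor of length `n` lies in the image of two consecutive
  -- letters, and two-letter factors recur within `R` letters. The extra block in `1 + R` is the one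
  -- containing `j`.
  obtain ⟨R, hR⟩ := h.isMinimalSeq_fixedPoint 2
  obtain ⟨C, hC⟩ := h.exists_scale
  refine ⟨(1 + R) * C, fun n hn i j => ?_⟩
  obtain ⟨p, hp⟩ := hC n hn
  obtain ⟨a, ha, ha'⟩ := ζ.exists_block_cut p i
  obtain ⟨b, hb, hb'⟩ := ζ.exists_block_cut p j
  obtain ⟨t, ht, hagree⟩ := exists_offset_of_infix (hR a (b + 1))
  obtain ⟨hc1, hc2⟩ := ζ.cut_congr p hagree
  have h1 := hc1 2 le_rfl
  have h2 := le_cut_add (fun b => (hp b).1) (a + 1) 1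
  have h3 := cut_add_le (fun b => (hp b).2) b (1 + R)
  have h4 := (ζ.cut_strictMono p).monotone (show b + 1 ≤ b + 1 + t by omega)
  have h5 := (ζ.cut_strictMono p).monotone (show b + 1 + t + 2 ≤ b + (1 + R) by omega)
  rw [show a + 1 + 1 = a + 2 by omega] at h2
  rw [← mul_assoc] at h3
  refine ⟨ζ.cut p (b + 1 + t) + (i - ζ.cut p a) - j, by omega, fun r hr => ?_⟩
  have := hc2 (i - ζ.cut p a + r) (by omega)
  rw [show ζ.cut p a + (i - ζ.cut p a + r) = i + r by omega] at this
  rw [this]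
  congr 1
  omega

end Substitution.IsPrimitive

/-! ### Equality patterns from finite data -/

section EqualityPattern

/-- The equality pattern of a sequence cut into boundedly many terms per window, where the terms
depend only on the window, is determined by finite data. -/
theorem exists_finite_pattern {ι 𝒲 : Type} {M : Type*} [Finite 𝒲] (W : ℕ → 𝒲) (T : ℕ)
    (c : ι → ℕ → ℕ) (m : ι → ℕ → M) (h0 : ∀ i, c i 0 = 0) (hmono : ∀ i, Monotone (c i))
    (hblock : ∀ i x, ∃ k, c i k ≤ x ∧ x < c i (k + 1)) (hT : ∀ i k, c i (k + 1) - c i k ≤ T)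
    (hW : ∀ i k k', W k = W k' → c i (k + 1) - c i k = c i (k' + 1) - c i k' ∧
      ∀ t < c i (k + 1) - c i k, m i (c i k + t) = m i (c i k' + t)) :
    ∃ (Δ : Type) (_ : Finite Δ) (δ : ι → Δ), ∀ i i', δ i = δ i' →
      ∀ x y, m i x = m i y ↔ m i' x = m i' y := by
  let 𝒯 := 𝒲 × Fin (T + 1)
  -- `L` records how many terms each window carries and so recovers `c i`; `E` records which pairs
  -- of (window, index in the block) carry equal terms.
  let L : ι → Set 𝒯 := fun i => {z | ∃ k, W k = z.1 ∧ c i (k + 1) - c i k = z.2}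
  let E : ι → Set (𝒯 × 𝒯) := fun i => {z | ∃ k k', W k = z.1.1 ∧ W k' = z.2.1 ∧
    z.1.2 < c i (k + 1) - c i k ∧ z.2.2 < c i (k' + 1) - c i k' ∧
    m i (c i k + z.1.2) = m i (c i k' + z.2.2)}
  have key : ∀ i i', (L i, E i) = (L i', E i') → ∀ x y, m i x = m i y → m i' x = m i' y := by
    intro i i' h
    rw [Prod.mk.injEq] at h
    obtain ⟨hL, hE⟩ := h
    have hd : ∀ k, c i (k + 1) - c i k = c i' (k + 1) - c i' k := fun k => by
      have h1 : ((W k, ⟨c i (k + 1) - c i k, by have := hT i k; omega⟩) : 𝒯) ∈ L i :=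
        ⟨k, rfl, rfl⟩
      rw [hL] at h1
      obtain ⟨k₂, h2, h3⟩ := h1
      rw [← (hW i' _ _ h2).1, h3]
    have hc : ∀ k, c i k = c i' k := fun k => by
      induction k with
      | zero => rw [h0, h0]
      | succ k ih =>
        have h1 := hd k
        have h2 := hmono i (Nat.le_add_right k 1)
        have h3 := hmono i' (Nat.le_add_right k 1)
        omega
    intro x y hxy
    obtain ⟨k, hk, hk'⟩ := hblock i x
    obtain ⟨l, hl, hl'⟩ := hblock i y
    have hTk := hT i k
    have hTl := hT i l
    have h1 : (((W k, ⟨x - c i k, by omega⟩), (W l, ⟨y - c i l, by omega⟩)) : 𝒯 × 𝒯) ∈ E i := by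
      refine ⟨k, l, rfl, rfl, ?_, ?_, ?_⟩
      · dsimp only
        omega
      · dsimp only
        omega
      · dsimp only
        rwa [show c i k + (x - c i k) = x by omega, show c i l + (y - c i l) = y by omega]
    rw [hE] at h1
    obtain ⟨k₂, l₂, h2, h3, h4, h5, h6⟩ := h1
    dsimp only at h2 h3 h4 h5 h6
    rw [(hW i' _ _ h2).2 _ h4, (hW i' _ _ h3).2 _ h5, ← hc, ← hc,
      show c i k + (x - c i k) = x by omega, show c i l + (y - c i l) = y by omega] at h6
    exact h6
  exact ⟨Set 𝒯 × Set (𝒯 × 𝒯), inferInstance, fun i => (L i, E i), fun i i' h x y =>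
    ⟨key i i' h x y, key i' i h.symm x y⟩⟩

theorem count_congr_of_lt {P Q : ℕ → Prop} [DecidablePred P] [DecidablePred Q] {n : ℕ}
    (h : ∀ i < n, P i ↔ Q i) : Nat.count P n = Nat.count Q n := by
  induction n with
  | zero => simp
  | succ n ih =>
    rw [Nat.count_succ, Nat.count_succ, ih fun i hi => h i (by omega)]
    simp only [h n (by omega)]

/-- `Nat.count P a + t` indexes the `t`-th occurrence from `a` on, counted from 0; its position
relative to `a` is read off from `P` on the interval of agreement. -/
theorem nth_count_add_congr {P : ℕ → Prop} [DecidablePred P] (hP : (Set.ofPred P).Infinite)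
    {a a' L i t : ℕ} (h : ∀ i ≤ L, P (a + i) ↔ P (a' + i)) (hi : i ≤ L)
    (ht : Nat.nth P (Nat.count P a + t) = a + i) :
    Nat.nth P (Nat.count P a' + t) = a' + i := by
  have h1 := Nat.count_nth_of_infinite hP (Nat.count P a + t)
  rw [ht, Nat.count_add] at h1
  have h2 : Nat.count (fun k => P (a + k)) i = Nat.count (fun k => P (a' + k)) i :=
    count_congr_of_lt fun j hj => h j (by omega)
  have h3 : P (a' + i) := (h i hi).1 (ht ▸ Nat.nth_mem_of_infinite hP _)
  have h4 := Nat.nth_count h3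
  rw [Nat.count_add, ← h2, show Nat.count (fun k => P (a + k)) i = t by omega] at h4
  exact h4

end EqualityPattern

/-! ### Finiteness of the set of derived sequences -/

section Finiteness

variable {A : Type*} {X : ℕ → A}

/-- Prefixes of length at least `p` have the same occurrences as the prefix of length `p`. -/
theorem finite_derivedSeqs_of_periodic {p : ℕ} (h : ∀ x, X (x + p) = X x)
    (hp : 0 < p) : (derivedSeqs X).Finite := by
  rw [derivedSeqs_eq_image]
  refine ((Set.finite_Iic p).image fun n => derivedSeq X (seqFactor X 0 n)).subset ?_
  rintro _ ⟨n, hn, rfl⟩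
  rcases Nat.lt_or_ge n p with hnp | hnp
  · exact ⟨n, hnp.le, rfl⟩
  have hmul : ∀ q x, X (x + p * q) = X x := fun q x => by
    induction q with
    | zero => simp
    | succ q ih => rw [Nat.mul_succ, ← add_assoc, h, ih]
  have hocc : OccursAt X (seqFactor X 0 p) = OccursAt X (seqFactor X 0 n) := by
    funext i
    rw [eq_iff_iff, occursAt_prefix_iff, occursAt_prefix_iff]
    refine ⟨fun hi r _ => ?_, fun hi r hr => hi r (by omega)⟩
    rw [← Nat.mod_add_div r p, ← add_assoc, hmul, hmul, hi _ (Nat.mod_lt r hp)]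
  refine ⟨p, Set.mem_Iic.2 le_rfl, derivedSeq_eq_of_returnWord fun k k' => ?_⟩
  simp only [returnWord, occurrence, hocc]

/-- Return words of a linearly recurrent sequence without periods have lengths at least
proportional to the length of the prefix. -/
theorem exists_sparse_occurrences (hX : ¬ ∃ p, 0 < p ∧ ∀ x, X (x + p) = X x) {K : ℕ}
    (hK : ∀ n, 1 ≤ n → ∀ i j, ∃ t, t + n ≤ K * n ∧ ∀ r < n, X (i + r) = X (j + t + r))
    {n i j : ℕ} (hij : i < j) (hi : OccursAt X (seqFactor X 0 n) i)
    (hj : OccursAt X (seqFactor X 0 n) j) : n ≤ 2 * K * (j - i) := by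
  rw [occursAt_prefix_iff] at hi hj
  by_contra! hlt
  obtain ⟨d, rfl⟩ := Nat.exists_eq_add_of_lt hij
  rw [show i + d + 1 - i = d + 1 by omega] at hlt
  refine hX ⟨d + 1, by omega, fun x => ?_⟩
  -- A too close recurrence gives the prefix the period `d + 1`. The factor of length `d + 2` at `x`
  -- holds both `x` and `x + (d + 1)` and occurs inside that prefix, so the period passes to all of
  -- `X`.
  obtain ⟨t, ht, ha⟩ := hK (d + 2) (by omega) x 0
  have h1 : K * (d + 2) ≤ 2 * K * (d + 1) := by nlinarith [Nat.zero_le (K * d)]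
  have h2 := ha 0 (by omega)
  have h3 := ha (d + 1) (by omega)
  simp only [zero_add, add_zero] at h2 h3
  rw [h3, h2, ← hi (t + (d + 1)) (by omega), ← hj t (by omega)]
  congr 1
  omega

theorem mul_le_occurrence_sub {P : ℕ → Prop} (hP : (Set.ofPred P).Infinite) {n c : ℕ}
    (h : ∀ i j, i < j → P i → P j → n ≤ c * (j - i)) (a t : ℕ) :
    t * n ≤ c * (Nat.nth P (a + t) - Nat.nth P a) := by
  induction t with
  | zero => simp
  | succ t ih =>
    have h1 := Nat.nth_strictMono hP (Nat.lt_add_one (a + t))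
    have h2 := (Nat.nth_strictMono hP).monotone (Nat.le_add_right a t)
    have h3 := h _ _ h1 (Nat.nth_mem_of_infinite hP _) (Nat.nth_mem_of_infinite hP _)
    rw [← add_assoc, add_mul, one_mul, show Nat.nth P (a + t + 1) - Nat.nth P a =
      (Nat.nth P (a + t) - Nat.nth P a) + (Nat.nth P (a + t + 1) - Nat.nth P (a + t)) by omega,
      mul_add]
    exact Nat.add_le_add ih h3

theorem IsPrimitiveSubstitutive.finite_derivedSeqs_of_not_periodic {B : Type} [Finite B]
    {ζ : Substitution B} (hζ : ζ.IsPrimitive) {φ : B → A} (hXY : ∀ x, X x = φ (ζ.fixedPoint x))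
    (hmin : IsMinimalSeq X) (hX : ¬ ∃ p, 0 < p ∧ ∀ x, X (x + p) = X x) :
    (derivedSeqs X).Finite := by
  classical
  obtain ⟨K, hK⟩ := hζ.exists_linear_recurrence
  obtain ⟨C, hC⟩ := hζ.exists_scale
  have hKX : ∀ n, 1 ≤ n → ∀ i j, ∃ t, t + n ≤ K * n ∧ ∀ r < n, X (i + r) = X (j + t + r) :=
    fun n hn i j => by
      obtain ⟨t, ht, ha⟩ := hK n hn i j
      exact ⟨t, ht, fun r hr => by rw [hXY, hXY, ha r hr]⟩
  choose! p hp using hC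
  let ι := {n : ℕ // 1 ≤ n}
  -- In units of `n`: `C` for a block, `K` to reach the end of a return word starting in it, and 1
  -- to recognise the prefix there.
  let w := C + K + 1
  let P : ι → ℕ → Prop := fun n => OccursAt X (seqFactor X 0 n)
  let s : ι → ℕ → ℕ := fun n => ζ.cut (p n)
  -- The windows are those of the fixed point itself, so one finite set serves all `n`.
  let W : ℕ → Fin w → B := fun k i => ζ.fixedPoint (k + i)
  have hPinf : ∀ n : ι, (Set.ofPred (P n)).Infinite := fun n => infinite_occursAt_prefix hmin n
  have hs : ∀ n : ι, StrictMono (s n) := fun n => ζ.cut_strictMono (p n)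
  have hs0 : ∀ n : ι, s n 0 = 0 := fun n => ζ.cut_zero (p n)
  have hblk : ∀ (n : ι) k, s n (k + 1) ≤ s n k + C * n := fun n k => by
    have := Substitution.cut_add_le (fun b => (hp n n.2 b).2) k 1
    simpa using this
  have hgap : ∀ (n : ι) N, Nat.nth (P n) (N + 1) ≤ Nat.nth (P n) N + K * n := fun n N => by
    obtain ⟨t, ht, ha⟩ := hKX n n.2 0 (Nat.nth (P n) N + 1)
    have h1 : P n (Nat.nth (P n) N + 1 + t) := occursAt_prefix_iff.2 fun r hr => by
      rw [← ha r hr, zero_add]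
    have hn := n.2
    by_contra! h2
    exact (isGap_nth (hPinf n) N).2.2 _ (by omega) (by omega) h1
  have hagree : ∀ (n : ι) k k', W k = W k' →
      s n (k + 1) + s n k' = s n (k' + 1) + s n k ∧
      (∀ r < w * n, X (s n k + r) = X (s n k' + r)) ∧
      ∀ i ≤ C * n + K * n, P n (s n k + i) ↔ P n (s n k' + i) := fun n k k' h => by
    obtain ⟨h1, h2⟩ := ζ.cut_congr (p n) (k := k) (k' := k') (l := w) fun r hr =>
      congrFun h ⟨r, hr⟩
    have h3 := Substitution.le_cut_add (fun b => (hp n n.2 b).1) k w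
    have h4 : ∀ r < w * n, X (s n k + r) = X (s n k' + r) := fun r hr => by
      rw [hXY, hXY]
      exact congrArg φ (h2 r (by omega))
    refine ⟨h1 1 (by omega), h4, fun i hi => ?_⟩
    simp only [P]
    rw [occursAt_prefix_iff, occursAt_prefix_iff]
    refine forall₂_congr fun r hr => ?_
    have hw : w * n = C * n + K * n + n := by simp only [w]; ring
    rw [add_assoc, add_assoc, h4 _ (by omega)]
  -- `Nat.count (P n) (s n k)` is the index of the first return word starting at or after the `k`-th
  -- cut. Gaps of at least `n / (2 * K)` in a block of length at most `C * n` leave at most `2 * K *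
  -- C + 1` starts.
  have hpattern := exists_finite_pattern W (2 * K * C + 1)
    (fun n k => Nat.count (P n) (s n k)) (fun n => returnWord X (seqFactor X 0 n))
    (fun n => by simp [hs0 n]) (fun n => (Nat.count_monotone _).comp (hs n).monotone)
  refine Exists.elim (hpattern ?_ ?_ ?_) ?_
  · intro n x
    obtain ⟨k, h1, h2⟩ := exists_block (hs n) (hs0 n) (Nat.nth (P n) x)
    exact ⟨k, Nat.le_nth_of_count_le h1, (Nat.lt_nth_iff_count_lt (hPinf n)).2 h2⟩
  · intro n k
    by_contra! hlt
    have hn := n.2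
    set a := Nat.count (P n) (s n k)
    have h1 : s n k ≤ Nat.nth (P n) a := Nat.le_nth_count (hPinf n) _
    have h2 : Nat.nth (P n) (a + (2 * K * C + 1)) < s n (k + 1) :=
      Nat.nth_lt_of_lt_count (by omega)
    have h3 := mul_le_occurrence_sub (hPinf n)
      (fun i j hij hi hj => exists_sparse_occurrences hX hKX hij hi hj) a (2 * K * C + 1)
    have h4 := hblk n k
    have h5 : 2 * K * (Nat.nth (P n) (a + (2 * K * C + 1)) - Nat.nth (P n) a) ≤
        2 * K * (C * n) := Nat.mul_le_mul_left _ (by omega)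
    nlinarith
  · intro n k k' h
    obtain ⟨h1, h2, h3⟩ := hagree n k k' h
    have hn := n.2
    have hb := hblk n k
    have hm := hs n (Nat.lt_add_one k)
    have hm' := hs n (Nat.lt_add_one k')
    have e1 : s n (k + 1) = s n k + (s n (k + 1) - s n k) := by omega
    have e2 : s n (k' + 1) = s n k' + (s n (k + 1) - s n k) := by omega
    refine ⟨?_, fun t ht => ?_⟩
    · rw [e1, e2, Nat.count_add, Nat.count_add, Nat.add_sub_cancel_left, Nat.add_sub_cancel_left]
      exact count_congr_of_lt fun i hi => h3 i (by omega)
    · have g1 : s n k ≤ Nat.nth (P n) (Nat.count (P n) (s n k) + t) :=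
        (Nat.le_nth_count (hPinf n) _).trans
          ((Nat.nth_strictMono (hPinf n)).monotone (Nat.le_add_right _ _))
      have g2 : Nat.nth (P n) (Nat.count (P n) (s n k) + t) < s n (k + 1) :=
        Nat.nth_lt_of_lt_count (by omega)
      have g3 := hgap n (Nat.count (P n) (s n k) + t)
      have g4 := Nat.nth_strictMono (hPinf n) (Nat.lt_add_one (Nat.count (P n) (s n k) + t))
      obtain ⟨i, hi⟩ := Nat.exists_eq_add_of_le g1
      obtain ⟨j, hj⟩ : ∃ j, Nat.nth (P n) (Nat.count (P n) (s n k) + t + 1) = s n k + j :=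
        Nat.exists_eq_add_of_le (by omega)
      have f1 := nth_count_add_congr (hPinf n) h3 (by omega) hi
      have f2 := nth_count_add_congr (hPinf n) h3 (i := j) (t := t + 1) (by omega) hj
      rw [← add_assoc] at f2
      simp only [returnWord, occurrence]
      have hw : w * n = C * n + K * n + n := by simp only [w]; ring
      rw [hi, hj, f1, f2, Nat.add_sub_add_left, Nat.add_sub_add_left, seqFactor_eq_iff]
      intro r hr
      rw [add_assoc, add_assoc]
      exact h2 _ (by omega)
  · rintro Δ ⟨_, δ, hδ⟩
    rw [derivedSeqs_eq_image]
    have hfac : Function.FactorsThrough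
        (fun n : ι => derivedSeq X (seqFactor X 0 n)) δ := fun n n' h =>
      derivedSeq_eq_of_returnWord (hδ n n' h)
    -- The derived sequence is a function of `δ`; the default value 0 is never used on the range of
    -- `δ`.
    refine ((Set.toFinite (Set.range δ)).image
      (Function.extend δ (fun n : ι => derivedSeq X (seqFactor X 0 n)) fun _ _ => 0)).subset ?_
    rintro _ ⟨n, hn, rfl⟩
    exact ⟨δ ⟨n, hn⟩, ⟨_, rfl⟩, hfac.extend_apply _ _⟩

end Finiteness

theorem IsPrimitiveSubstitutive.isMinimalSeq {A : Type*} {X : ℕ → A}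
    (h : IsPrimitiveSubstitutive X) : IsMinimalSeq X := by
  obtain ⟨B, _, ζ, φ, hζ, rfl⟩ := h
  intro l
  obtain ⟨k, hk⟩ := hζ.isMinimalSeq_fixedPoint l
  refine ⟨k, fun i j => ?_⟩
  obtain ⟨t, ht, ha⟩ := exists_offset_of_infix (hk i j)
  exact infix_of_offset ht fun r hr => congrArg φ (ha r hr)

theorem IsPrimitiveSubstitutive.finite_derivedSeqs {A : Type*} {X : ℕ → A}
    (h : IsPrimitiveSubstitutive X) : (derivedSeqs X).Finite := by
  have hmin := h.isMinimalSeq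
  by_cases hper : ∃ p, 0 < p ∧ ∀ x, X (x + p) = X x
  · obtain ⟨p, hp, hX⟩ := hper
    exact finite_derivedSeqs_of_periodic hX hp
  · obtain ⟨B, _, ζ, φ, hζ, hX⟩ := h
    exact finite_derivedSeqs_of_not_periodic hζ (congrFun hX) hmin hper

theorem theorem1 {A : Type*} [Finite A] (X : ℕ → A) :
    IsPrimitiveSubstitutive X ↔ IsMinimalSeq X ∧ (derivedSeqs X).Finite :=
  ⟨fun h => ⟨h.isMinimalSeq, h.finite_derivedSeqs⟩, fun h => h.1.isPrimitiveSubstitutive h.2⟩
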